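/- **Conventions.** For a topological space $X$, the natural order is given by $x\le y$ iff the principal filter at $x$ converges to $y$ (every open neighbourhood of $y$ contains $x$). A $T_0$-space $X$ is a *topological $\bigwedge$-semilattice* if it is a complete lattice in its natural order and, for every set $I$, the map $\bigwedge\colon X^I\to X$ is continuous. Let $UX$ be the set of ultrafilters on $X$, with the topology generated by the sets $\{\mathfrak x\in UX\mid V\in\mathfrak x\}$, $V\subseteq X$ open, and its natural order; for a map $h\colon Y\to Z$ let $Uh\colon UY\to UZ$ be the pushforward of ultrafilters; write $\mathfrak x\leadsto x$ if $\mathfrak x$ converges to $x$. We say that *binary infima preserve smallest convergence points in $X$* if the monotone map $X\to UX$ sending a point to its principal ultrafilter has a left adjoint $\sigma\colon UX\to X$ (that is, every ultrafilter $\mathfrak x$ on $X$ has a smallest convergence point, namely $\sigma(\mathfrak x)$), and for every ultrafilter $\mathfrak w$ on $X\times X$ $$\sigma\big(U{\wedge}(\mathfrak w)\big)=\sigma\big(U\pi_1(\mathfrak w)\big)\wedge\sigma\big(U\pi_2(\mathfrak w)\big).$$ $\mathsf{Top}{\Downarrow}X$ is the category whose objects are pairs $(A,\alpha)$ with $A$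 a topological space and $\alpha\colon A\to X$ continuous, and whose morphisms $(A,\alpha)\to(B,\beta)$ are the continuous maps $f\colon A\to B$ with $\alpha(a)\le\beta(f(a))$ for all $a\in A$. $\mathsf{Fam}(X)$ is the category whose objects are families $(x_i)_{i\in I}$ of elements of $X$ indexed by sets, and whose morphisms $(x_i)_{i\in I}\to(y_j)_{j\in J}$ are the maps $f\colon I\to J$ with $x_i\le y_{f(i)}$ for all $i\in I$. A morphism $p\colon A\to B$ in a category $\mathsf C$ with pullbacks is *effective for descent* if the change-of-base functor $p^*\colon\mathsf C/B\to\mathsf C/A$ is monadic. **Theorem.** Let $X$ be a topological $\bigwedge$-semilattice in which binary infima preserve smallest convergence points, with $\sigma\colon UX\to X$ as above. Let $f\colon(A,\alpha)\to(B,\beta)$ be a morphism in $\mathsf{Top}{\Downarrow}X$ such that $f\colon(\alpha(a))_{a\in A}\to(\beta(b))_{b\in B}$ is effective for descent in $\mathsf{Fam}(X)$. Then $f\colon(A,\alpha)\to(B,\beta)$ is effective for descent in $\mathsf{Top}{\Downarrow}X$ if and only if the following two conditions hold. 1. $f\colon A\to B$ is effective for descent in $\mathsf{Top}$. 2. For every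 ultrafilter $\mathfrak b$ on $B$ and every $b\in B$ with $\mathfrak b\leadsto b$, and for every $w\in X$ with $w\le\sigma(U\beta(\mathfrak b))$, $$w=\bigvee\{\,w\wedge\sigma(U\alpha(\mathfrak a))\mid \mathfrak a\in UA,\ a\in A,\ \mathfrak a\leadsto a,\ Uf(\mathfrak a)=\mathfrak b,\ f(a)=b\,\}.$$ -/

import Mathlib

open CategoryTheory CategoryTheory.Limits Filter Topology

universe v u

/-! ## Effective descent morphisms -/

/-- A morphism `p : A ⟶ B` of a category with pullbacks is effective for descent if the comparison
functor from `C/B` to the Eilenberg-Moore category of the monad on `C/A` induced by the adjunction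
`p_! ⊣ p^*` is an equivalence, that is, if the change-of-base functor `p^*` is monadic. -/
def IsEffectiveDescent {C : Type u} [Category.{v} C] [HasPullbacks C] {A B : C} (p : A ⟶ B) :
    Prop :=
  (Monad.comparison (Over.mapPullbackAdj p)).IsEquivalence

/-! ## Topological complete meet-semilattices -/

/-- A topological `⋀`-semilattice: a space that is a complete lattice with respect to its natural
order, and whose infimum maps `X^I → X` are continuous.  In the natural order, `x ≤ y` means that
the principal filter of `x` converges to `y`. Antisymmetry says precisely that the space is T0. -/
class TopologicalInfLattice (X : Type u) [TopologicalSpace X] extends CompleteLattice X where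
  /-- the order is the natural order of the space -/
  le_iff_pure_le_nhds : ∀ x y : X, x ≤ y ↔ (pure x : Filter X) ≤ 𝓝 y
  /-- infima of families are continuous for the product topology -/
  continuous_iInf : ∀ I : Type u, Continuous fun x : I → X => ⨅ i, x i

theorem TopologicalInfLattice.le_iff_specializes {X : Type u} [TopologicalSpace X]
    [TopologicalInfLattice X] (x y : X) : x ≤ y ↔ x ⤳ y :=
  (TopologicalInfLattice.le_iff_pure_le_nhds x y).trans specializes_iff_pure.symm

theorem TopologicalInfLattice.t0Space (X : Type u) [TopologicalSpace X]
    [TopologicalInfLattice X] : T0Space X :=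
  ⟨fun x y h => le_antisymm
    ((TopologicalInfLattice.le_iff_specializes x y).2 h.specializes)
    ((TopologicalInfLattice.le_iff_specializes y x).2 h.symm.specializes)⟩

theorem TopologicalInfLattice.continuous_inf {X : Type u} [TopologicalSpace X]
    [TopologicalInfLattice X] : Continuous fun p : X × X => p.1 ⊓ p.2 := by
  have h := TopologicalInfLattice.continuous_iInf (X := X) (ULift.{u} Bool)
  have h2 : Continuous fun p : X × X => fun i : ULift.{u} Bool => cond i.down p.1 p.2 := by
    refine continuous_pi ?_
    rintro ⟨_ | _⟩
    · exact continuous_snd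
    · exact continuous_fst
  convert h.comp h2 using 2 with p
  simp [iInf_ulift, iInf_bool_eq]

/-! ## Ultrafilters and smallest convergence points -/

/-- The natural order on the set of ultrafilters on a space `X`, where the ultrafilters carry the
topology generated by the sets `{𝔵 | B ∈ 𝔵}` with `B` open in `X`. -/
def UltrafilterLE {X : Type u} [TopologicalSpace X] (𝔵 𝔶 : Ultrafilter X) : Prop :=
  ∀ B : Set X, IsOpen B → B ∈ 𝔶 → B ∈ 𝔵

/-- `σ` is a left adjoint, with respect to the natural orders, of the map sending a point of `X` to
its principal ultrafilter. Equivalently, `σ 𝔵` is the smallest convergence point of `𝔵`. -/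
structure IsLeftAdjointOfUnit {X : Type u} [TopologicalSpace X] [Preorder X]
    (σ : Ultrafilter X → X) : Prop where
  monotone : ∀ 𝔵 𝔶 : Ultrafilter X, UltrafilterLE 𝔵 𝔶 → σ 𝔵 ≤ σ 𝔶
  le_iff : ∀ (𝔵 : Ultrafilter X) (x : X), σ 𝔵 ≤ x ↔ UltrafilterLE 𝔵 (pure x)

/-- Binary infima preserve smallest convergence points: `σ` is left adjoint to the unit `X → UX`,
and `σ ∘ U(∧) = ∧ ∘ (σ × σ) ∘ can` as maps `U(X × X) → X`. -/
structure InfPreservesSmallestLimits {X : Type u} [TopologicalSpace X] [SemilatticeInf X]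
    (σ : Ultrafilter X → X) : Prop where
  isLeftAdjoint : IsLeftAdjointOfUnit σ
  map_inf : ∀ 𝔴 : Ultrafilter (X × X),
    σ (𝔴.map fun p => p.1 ⊓ p.2) = σ (𝔴.map Prod.fst) ⊓ σ (𝔴.map Prod.snd)

/-! ## The category of families -/

/-- Families `(x_i)_{i ∈ I}` of elements of an ordered set `X`. -/
structure Fam (X : Type u) : Type (u + 1) where
  index : Type u
  val : index → X

namespace Fam

variable {X : Type u}

/-- A morphism of families is a map of the index sets with `x_i ≤ y_{f i}` for all `i`. -/
@[ext]
structure Hom [Preorder X] (P Q : Fam X) : Type u where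
  map : P.index → Q.index
  val_le : ∀ i, P.val i ≤ Q.val (map i)

instance [Preorder X] : Category (Fam X) where
  Hom := Hom
  id P := ⟨id, fun _ => le_rfl⟩
  comp f g := ⟨g.map ∘ f.map, fun i => (f.val_le i).trans (g.val_le (f.map i))⟩

@[ext]
theorem hom_ext [Preorder X] {P Q : Fam X} {f g : P ⟶ Q} (h : ∀ i, f.map i = g.map i) : f = g :=
  Hom.ext (funext h)

@[simp]
theorem id_map [Preorder X] (P : Fam X) (i : P.index) : Hom.map (𝟙 P) i = i := rfl

@[simp]
theorem comp_map [Preorder X] {P Q R : Fam X} (f : P ⟶ Q) (g : Q ⟶ R) (i : P.index) :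
    (f ≫ g).map i = g.map (f.map i) := rfl

instance [SemilatticeInf X] : HasPullbacks (Fam X) := by
  refine @hasPullbacks_of_hasLimit_cospan _ _ ?_
  intro P Q R f g
  let W : Fam X :=
    ⟨{p : P.index × Q.index // f.map p.1 = g.map p.2}, fun p => P.val p.1.1 ⊓ Q.val p.1.2⟩
  let p₁ : W ⟶ P := ⟨fun p => p.1.1, fun _ => inf_le_left⟩
  let p₂ : W ⟶ Q := ⟨fun p => p.1.2, fun _ => inf_le_right⟩
  have w : p₁ ≫ f = p₂ ≫ g := hom_ext fun p => p.2
  have hl : IsLimit (PullbackCone.mk p₁ p₂ w) := by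
    refine PullbackCone.IsLimit.mk w
      (fun s => ⟨fun i => ⟨(s.fst.map i, s.snd.map i),
        congrArg (fun h : s.pt ⟶ R => h.map i) s.condition⟩,
        fun i => le_inf (s.fst.val_le i) (s.snd.val_le i)⟩) (fun s => rfl) (fun s => rfl) ?_
    intro s m h₁ h₂
    refine hom_ext fun i => Subtype.ext (Prod.ext ?_ ?_)
    · exact congrArg (fun h : s.pt ⟶ P => h.map i) h₁
    · exact congrArg (fun h : s.pt ⟶ Q => h.map i) h₂
  exact ⟨⟨⟨_, hl⟩⟩⟩

end Fam

/-! ## The lax comma category -/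

/-- Objects of the lax comma category `Top ⇓ X`: pairs `(A, α)` of a space `A` and a continuous map
`α : A → X`. -/
structure LaxTop (X : Type u) [TopologicalSpace X] : Type (u + 1) where
  space : TopCat.{u}
  val : C(space, X)

namespace LaxTop

variable {X : Type u} [TopologicalSpace X]

/-- Morphisms `(A, α) → (B, β)` are the continuous maps `f : A → B` with `α ≤ β ∘ f`, pointwise
in the natural order of `X`. -/
@[ext]
structure Hom (P Q : LaxTop X) : Type u where
  map : P.space ⟶ Q.space
  val_le : ∀ a, P.val a ⤳ Q.val (map a)

instance : Category (LaxTop X) where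
  Hom := Hom
  id P := ⟨𝟙 P.space, fun _ => specializes_rfl⟩
  comp f g := ⟨f.map ≫ g.map, fun a => (f.val_le a).trans (g.val_le (f.map a))⟩

theorem hom_ext {P Q : LaxTop X} {f g : P ⟶ Q} (h : f.map = g.map) : f = g :=
  Hom.ext h

variable (X) in
/-- The forgetful functor to topological spaces. -/
def toTop : LaxTop X ⥤ TopCat.{u} where
  obj P := P.space
  map f := f.map

variable (X) in
/-- The forgetful functor to families, forgetting the topology of the domain. -/
def toFam [TopologicalInfLattice X] : LaxTop X ⥤ Fam X where
  obj P := ⟨P.space, P.val⟩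
  map f := ⟨f.map, fun a => (TopologicalInfLattice.le_iff_specializes _ _).2 (f.val_le a)⟩

instance [TopologicalInfLattice X] : HasPullbacks (LaxTop X) := by
  refine @hasPullbacks_of_hasLimit_cospan _ _ ?_
  intro P Q R f g
  have hle := @TopologicalInfLattice.le_iff_specializes X _ _
  let W : LaxTop X :=
    ⟨TopCat.of {p : P.space × Q.space // f.map p.1 = g.map p.2},
      ⟨fun p => P.val p.1.1 ⊓ Q.val p.1.2, TopologicalInfLattice.continuous_inf.comp
        (((P.val.continuous.comp continuous_fst).prodMk
          (Q.val.continuous.comp continuous_snd)).comp continuous_subtype_val)⟩⟩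
  let p₁ : W ⟶ P := ⟨TopCat.ofHom ⟨fun p => p.1.1, continuous_fst.comp continuous_subtype_val⟩,
    fun _ => (hle _ _).1 inf_le_left⟩
  let p₂ : W ⟶ Q := ⟨TopCat.ofHom ⟨fun p => p.1.2, continuous_snd.comp continuous_subtype_val⟩,
    fun _ => (hle _ _).1 inf_le_right⟩
  have w : p₁ ≫ f = p₂ ≫ g := hom_ext (TopCat.hom_ext (ContinuousMap.ext fun p => p.2))
  have hl : IsLimit (PullbackCone.mk p₁ p₂ w) := by
    refine PullbackCone.IsLimit.mk w
      (fun s => ⟨TopCat.ofHom ⟨fun i => ⟨(s.fst.map i, s.snd.map i),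
        congrArg (fun h : s.pt ⟶ R => h.map i) s.condition⟩,
        Continuous.subtype_mk (s.fst.map.hom.continuous.prodMk s.snd.map.hom.continuous) _⟩,
        fun i => (hle _ _).1 (le_inf ((hle _ _).2 (s.fst.val_le i)) ((hle _ _).2 (s.snd.val_le i)))⟩)
      (fun s => rfl) (fun s => rfl) ?_
    intro s m h₁ h₂
    refine hom_ext (TopCat.hom_ext (ContinuousMap.ext fun i => Subtype.ext (Prod.ext ?_ ?_)))
    · exact congrArg (fun h : s.pt ⟶ P => h.map i) h₁
    · exact congrArg (fun h : s.pt ⟶ Q => h.map i) h₂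
  exact ⟨⟨⟨_, hl⟩⟩⟩

end LaxTop

/-!
A morphism `p` of a category with pullbacks is effective for descent iff change of base along `p` is
fully faithful into the actions of the kernel pair of `p` (`DescentFullyFaithful`) and every such
action is the canonical one on some base change (`DescentEffective`). Phrased with generalized
elements this needs no chosen pullbacks (`IsEffectiveDescent.fullyFaithful`,
`IsEffectiveDescent.effective`, `IsEffectiveDescent.of_fullyFaithful_of_effective`), so that it can
be applied in spaces, families and the lax comma category with whatever pullback squares are at
hand.

A pullback square in `Top ⇓ X` is a pullback square of spaces whose corner carries the pointwise
meet of the values, and an action in `Top ⇓ X` is an action of spaces together with an inequality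
between values that concerns single points only. Descent in families therefore says what happens at
each point: values over `b` are detected by their meets with the values of `A` on the fibre over
`b`, and a compatible family of values on that fibre is cut out by its join.

Suppose that `f` is effective in `Top` and that the ultrafilter condition holds. An action on `E` in
`Top ⇓ X` descends to a space `D` over `B`, and the only candidate for the values on `D` is the
join `δ` over the fibres of `E ⟶ D`. The point is that `δ` is continuous, that is,
`σ (𝔡.map δ) ≤ δ x` whenever `𝔡` converges to `x`. By the ultrafilter condition it suffices to bound
`σ (𝔡.map δ) ⊓ σ (𝔞.map α)` for the `𝔞` that lie over the same ultrafilter on `B` as `𝔡`. Then `𝔞`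
and `𝔡` lift to an ultrafilter on the pullback `E`, where the meet of the two is continuous, and `σ`
preserves binary meets (`LaxTop.descentEffective_of_top`).

Conversely, giving spaces over `A` and `B` the values pulled back from `A` and `B` embeds descent in
`Top` into descent in `Top ⇓ X`. For the ultrafilter condition, let `u` be an upper bound of the
set and let `D` be the space over `B` in which `𝔟` converges to one additional point and all other
points are isolated. The function that is `w ⊓ β` on the isolated points and `w ⊓ u` at the limit
need not be continuous on `D`, but its meet with `α` is continuous on `A ×_B D`, where it defines an
action. Effectiveness of this action forces the function to be continuous, whence `w ≤ u`
(`LaxTop.le_of_descentEffective`).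
-/

/-! ### Effective descent through generalized elements -/

section GeneralizedElements

variable {C : Type u} [Category.{v} C] {A B : C}

/-- An action of the kernel pair of `p : A ⟶ B` on `q : E ⟶ A`, that is, an Eilenberg-Moore algebra
for the monad of `p_! ⊣ p^*`, written in terms of generalized elements: `act e a` moves the element
`e` of `E` to the fibre of `q` over `a`, where `a` and `q e` have the same image in `B`. In this
form no pullback has to be chosen. -/
structure DescentAction (p : A ⟶ B) {E : C} (q : E ⟶ A) where
  /-- transport of a generalized element of `E` to the fibre over `a` -/
  act : ∀ {T : C} (e : T ⟶ E) (a : T ⟶ A), (e ≫ q) ≫ p = a ≫ p → (T ⟶ E)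
  act_comp : ∀ {T : C} (e : T ⟶ E) (a : T ⟶ A) (h : (e ≫ q) ≫ p = a ≫ p), act e a h ≫ q = a
  comp_act : ∀ {S T : C} (t : S ⟶ T) (e : T ⟶ E) (a : T ⟶ A) (h : (e ≫ q) ≫ p = a ≫ p)
    (h' : ((t ≫ e) ≫ q) ≫ p = (t ≫ a) ≫ p), t ≫ act e a h = act (t ≫ e) (t ≫ a) h'
  act_self : ∀ {T : C} (e : T ⟶ E), act e (e ≫ q) rfl = e
  act_act : ∀ {T : C} (e : T ⟶ E) (a a' : T ⟶ A) (h : (e ≫ q) ≫ p = a ≫ p)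
    (h' : (act e a h ≫ q) ≫ p = a' ≫ p) (h'' : (e ≫ q) ≫ p = a' ≫ p),
    act (act e a h) a' h' = act e a' h''

theorem DescentAction.act_congr {p : A ⟶ B} {E : C} {q : E ⟶ A} (M : DescentAction p q) {T : C}
    {e e' : T ⟶ E} {a a' : T ⟶ A} (h : (e ≫ q) ≫ p = a ≫ p) (he : e = e') (ha : a = a') :
    M.act e a h = M.act e' a' (by rw [← he, ← ha, h]) := by
  subst he ha
  rfl

/-- The canonical action on a base change of `p`: it changes the second factor. -/
noncomputable def DescentAction.ofIsPullback {p : A ⟶ B} {P D : C} {s : P ⟶ D} {q : P ⟶ A}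
    {d : D ⟶ B} (hP : IsPullback s q d p) : DescentAction p q :=
  have w : ∀ {T : C} (e : T ⟶ P) (a : T ⟶ A), (e ≫ q) ≫ p = a ≫ p → (e ≫ s) ≫ d = a ≫ p :=
    fun e a h => by rw [Category.assoc, hP.w, ← Category.assoc, h]
  { act := fun e a h => hP.lift (e ≫ s) a (w e a h)
    act_comp := fun e a h => hP.lift_snd _ _ _
    comp_act := fun t e a h h' => by
      apply hP.hom_ext
      · rw [Category.assoc, hP.lift_fst, hP.lift_fst, Category.assoc]
      · rw [Category.assoc, hP.lift_snd, hP.lift_snd]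
    act_self := fun e => hP.hom_ext (hP.lift_fst _ _ _) (hP.lift_snd _ _ _)
    act_act := fun e a a' h h' h'' => by
      apply hP.hom_ext
      · rw [hP.lift_fst, hP.lift_fst, hP.lift_fst]
      · rw [hP.lift_snd, hP.lift_snd] }

theorem DescentAction.ofIsPullback_act_comp {p : A ⟶ B} {P D : C} {s : P ⟶ D} {q : P ⟶ A}
    {d : D ⟶ B} (hP : IsPullback s q d p) {T : C} (e : T ⟶ P) (a : T ⟶ A)
    (h : (e ≫ q) ≫ p = a ≫ p) : (ofIsPullback hP).act e a h ≫ s = e ≫ s :=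
  hP.lift_fst _ _ _

/-- The change-of-base functor along `p` is fully faithful into algebras: every base change `s` of
`p` is the coequalizer of its kernel pair, as far as maps over `B` are concerned. -/
def DescentFullyFaithful (p : A ⟶ B) : Prop :=
  ∀ ⦃P D D' : C⦄ (s : P ⟶ D) (q : P ⟶ A) (d : D ⟶ B) (d' : D' ⟶ B) (g : P ⟶ D'),
    IsPullback s q d p → g ≫ d' = q ≫ p →
    (∀ ⦃T : C⦄ (x y : T ⟶ P), x ≫ s = y ≫ s → x ≫ g = y ≫ g) →
    ∃! k : D ⟶ D', k ≫ d' = d ∧ s ≫ k = g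

/-- Every action of the kernel pair of `p` is the canonical action on a base change along `p`. -/
def DescentEffective (p : A ⟶ B) : Prop :=
  ∀ ⦃E : C⦄ (q : E ⟶ A) (M : DescentAction p q), ∃ (D : C) (d : D ⟶ B) (s : E ⟶ D),
    IsPullback s q d p ∧
      ∀ ⦃T : C⦄ (e : T ⟶ E) (a : T ⟶ A) (h : (e ≫ q) ≫ p = a ≫ p), M.act e a h ≫ s = e ≫ s

variable [HasPullbacks C] (p : A ⟶ B)

/-!
The components of the monad of `p_! ⊣ p^*` are stated in terms of the pullback projections. Their
sources and targets are the displayed pullbacks only up to unfolding, which is why the proofs below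
establish each identity for arbitrary morphisms `r`, `t` between these pullbacks with the right
projections.
-/

theorem monad_unit_fst (E : Over A) :
    Over.Hom.left ((Over.mapPullbackAdj p).toMonad.η.app E) ≫ pullback.fst (E.hom ≫ p) p = 𝟙 _ := by
  rw [Adjunction.toMonad_η, Over.mapPullbackAdj_unit_app]
  exact pullback.lift_fst _ _ _

theorem monad_unit_snd (E : Over A) :
    Over.Hom.left ((Over.mapPullbackAdj p).toMonad.η.app E) ≫ pullback.snd (E.hom ≫ p) p =
      E.hom := by
  rw [Adjunction.toMonad_η, Over.mapPullbackAdj_unit_app]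
  exact pullback.lift_snd _ _ _

theorem pullback_counit_fst (D : Over B) :
    ((Over.pullback p).map ((Over.mapPullbackAdj p).counit.app D)).left ≫ pullback.fst D.hom p =
      pullback.fst (pullback.snd D.hom p ≫ p) p ≫ pullback.fst D.hom p := by
  rw [Over.mapPullbackAdj_counit_app]
  exact pullback.lift_fst _ _ _

theorem pullback_counit_snd (D : Over B) :
    ((Over.pullback p).map ((Over.mapPullbackAdj p).counit.app D)).left ≫ pullback.snd D.hom p =
      pullback.snd (pullback.snd D.hom p ≫ p) p := by
  rw [Over.mapPullbackAdj_counit_app]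
  exact pullback.lift_snd _ _ _

theorem monad_mul_fst (E : Over A) :
    Over.Hom.left ((Over.mapPullbackAdj p).toMonad.μ.app E) ≫ pullback.fst (E.hom ≫ p) p =
      pullback.fst (pullback.snd (E.hom ≫ p) p ≫ p) p ≫ pullback.fst (E.hom ≫ p) p :=
  pullback_counit_fst p ((Over.map p).obj E)

theorem monad_mul_snd (E : Over A) :
    Over.Hom.left ((Over.mapPullbackAdj p).toMonad.μ.app E) ≫ pullback.snd (E.hom ≫ p) p =
      pullback.snd (pullback.snd (E.hom ≫ p) p ≫ p) p :=
  pullback_counit_snd p ((Over.map p).obj E)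

theorem pullback_map_fst {D D' : Over B} (k : D ⟶ D') :
    ((Over.pullback p).map k).left ≫ pullback.fst D'.hom p = pullback.fst D.hom p ≫ k.left :=
  pullback.lift_fst _ _ _

theorem pullback_map_snd {D D' : Over B} (k : D ⟶ D') :
    ((Over.pullback p).map k).left ≫ pullback.snd D'.hom p = pullback.snd D.hom p :=
  pullback.lift_snd _ _ _

theorem monad_map_fst {E F : Over A} (h : E ⟶ F) :
    Over.Hom.left (((Over.mapPullbackAdj p).toMonad : Over A ⥤ Over A).map h) ≫
        pullback.fst (F.hom ≫ p) p = pullback.fst (E.hom ≫ p) p ≫ h.left :=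
  pullback.lift_fst _ _ _

theorem monad_map_snd {E F : Over A} (h : E ⟶ F) :
    Over.Hom.left (((Over.mapPullbackAdj p).toMonad : Over A ⥤ Over A).map h) ≫
        pullback.snd (F.hom ≫ p) p = pullback.snd (E.hom ≫ p) p :=
  pullback.lift_snd _ _ _

/-- The algebra given by an action: its structure map is the action on the generic pair. -/
noncomputable def DescentAction.toAlgebra {p : A ⟶ B} {E : C} {q : E ⟶ A} (M : DescentAction p q) :
    (Over.mapPullbackAdj p).toMonad.Algebra :=
  have hc : (pullback.fst (q ≫ p) p ≫ q) ≫ p = pullback.snd (q ≫ p) p ≫ p := by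
    rw [Category.assoc, pullback.condition]
  let a : (Over.pullback p).obj ((Over.map p).obj (Over.mk q)) ⟶ Over.mk q :=
    Over.homMk (M.act (pullback.fst (q ≫ p) p) (pullback.snd (q ≫ p) p) hc) (M.act_comp _ _ _)
  { A := Over.mk q
    a := a
    unit := by
      refine Over.OverMorphism.ext ?_
      have h : ∀ t : E ⟶ pullback (q ≫ p) p, t ≫ pullback.fst _ _ = 𝟙 E →
          t ≫ pullback.snd _ _ = q → t ≫ M.act _ _ hc = 𝟙 E := by
        intro t h₁ h₂
        rw [M.comp_act t _ _ hc (by simp only [Category.assoc, pullback.condition]),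
          M.act_congr _ h₁ (h₂.trans (Category.id_comp q).symm), M.act_self]
      exact h _ (monad_unit_fst p (Over.mk q)) (monad_unit_snd p (Over.mk q))
    assoc := by
      refine Over.OverMorphism.ext ?_
      have h : ∀ t t' : pullback (pullback.snd (q ≫ p) p ≫ p) p ⟶ pullback (q ≫ p) p,
          t ≫ pullback.fst _ _ = pullback.fst _ _ ≫ pullback.fst _ _ →
          t ≫ pullback.snd _ _ = pullback.snd _ _ →
          t' ≫ pullback.fst _ _ = pullback.fst _ _ ≫ M.act _ _ hc →
          t' ≫ pullback.snd _ _ = pullback.snd _ _ →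
          t ≫ M.act _ _ hc = t' ≫ M.act _ _ hc := by
        intro t t' h₁ h₂ h₁' h₂'
        have hr : ∀ r : pullback (pullback.snd (q ≫ p) p ≫ p) p ⟶ pullback (q ≫ p) p,
            ((r ≫ pullback.fst _ _) ≫ q) ≫ p = (r ≫ pullback.snd _ _) ≫ p := fun r => by
          simp only [Category.assoc, pullback.condition]
        have h₃ := h₁'.trans (M.comp_act _ _ _ hc (hr _))
        rw [M.comp_act t _ _ hc (hr _), M.comp_act t' _ _ hc (hr _), M.act_congr _ h₁ h₂,
          M.act_congr _ h₃ h₂', M.act_act]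
      exact h _ _ (monad_mul_fst p (Over.mk q)) (monad_mul_snd p (Over.mk q))
        (monad_map_fst p a) (monad_map_snd p a) }

/-- The action of an algebra, given by its structure map. -/
noncomputable def DescentAction.ofAlgebra {p : A ⟶ B}
    (M : (Over.mapPullbackAdj p).toMonad.Algebra) : DescentAction p M.A.hom :=
  let ξ : pullback (M.A.hom ≫ p) p ⟶ M.A.left := Over.Hom.left M.a
  have hξ : ξ ≫ M.A.hom = pullback.snd _ _ := Over.w M.a
  { act := fun e a h => pullback.lift e a (by rw [← h, Category.assoc]) ≫ ξ
    act_comp := fun e a h => by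
      rw [Category.assoc, hξ, pullback.lift_snd]
    comp_act := fun t e a h h' => by
      rw [← Category.assoc]
      congr 1
      apply pullback.hom_ext
      · rw [Category.assoc, pullback.lift_fst, pullback.lift_fst]
      · rw [Category.assoc, pullback.lift_snd, pullback.lift_snd]
    act_self := fun e => by
      have h : ∀ t : M.A.left ⟶ pullback (M.A.hom ≫ p) p, t ≫ pullback.fst _ _ = 𝟙 _ →
          t ≫ pullback.snd _ _ = M.A.hom → t ≫ ξ = 𝟙 _ →
          pullback.lift e (e ≫ M.A.hom) (by rw [Category.assoc]) ≫ ξ = e := by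
        intro t h₁ h₂ h₃
        have : pullback.lift e (e ≫ M.A.hom) (by rw [Category.assoc]) = e ≫ t := by
          apply pullback.hom_ext
          · rw [pullback.lift_fst, Category.assoc, h₁, Category.comp_id]
          · rw [pullback.lift_snd, Category.assoc, h₂]
        rw [this, Category.assoc, h₃, Category.comp_id]
      exact h _ (monad_unit_fst p M.A) (monad_unit_snd p M.A) (congrArg Over.Hom.left M.unit)
    act_act := fun {T} e a a' h h' h'' => by
      have h : ∀ t t' : pullback (pullback.snd (M.A.hom ≫ p) p ≫ p) p ⟶ pullback (M.A.hom ≫ p) p,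
          t ≫ pullback.fst _ _ = pullback.fst _ _ ≫ pullback.fst _ _ →
          t ≫ pullback.snd _ _ = pullback.snd _ _ →
          t' ≫ pullback.fst _ _ = pullback.fst _ _ ≫ ξ →
          t' ≫ pullback.snd _ _ = pullback.snd _ _ →
          t ≫ ξ = t' ≫ ξ →
          pullback.lift (pullback.lift e a (by rw [← h, Category.assoc]) ≫ ξ) a'
              (by simp only [← h', Category.assoc]) ≫ ξ =
            pullback.lift e a' (by rw [← h'', Category.assoc]) ≫ ξ := by
        intro t t' h₁ h₂ h₁' h₂' h₃
        let r : T ⟶ pullback (pullback.snd (M.A.hom ≫ p) p ≫ p) p :=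
          pullback.lift (pullback.lift e a (by rw [← h, Category.assoc])) a'
            (by rw [pullback.lift_snd_assoc, ← h, h''])
        have e₁ : r ≫ t = pullback.lift e a' (by rw [← h'', Category.assoc]) := by
          apply pullback.hom_ext
          · rw [Category.assoc, h₁, pullback.lift_fst_assoc, pullback.lift_fst, pullback.lift_fst]
          · rw [Category.assoc, h₂, pullback.lift_snd, pullback.lift_snd]
        have e₂ : r ≫ t' = pullback.lift (pullback.lift e a (by rw [← h, Category.assoc]) ≫ ξ) a'
              (by simp only [← h', Category.assoc]) := by
          apply pullback.hom_ext
          · rw [Category.assoc, h₁', pullback.lift_fst_assoc, pullback.lift_fst]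
          · rw [Category.assoc, h₂', pullback.lift_snd, pullback.lift_snd]
        rw [← e₁, ← e₂, Category.assoc, Category.assoc, h₃]
      exact h _ _ (monad_mul_fst p M.A) (monad_mul_snd p M.A) (monad_map_fst p M.a)
        (monad_map_snd p M.a) (congrArg Over.Hom.left M.assoc) }

/-- Algebra morphisms between base changes are the morphisms over `A` that respect the fibres of the
projection to the original object. -/
theorem comparison_hom_exists {D D' : Over B}
    (h : (Over.pullback p).obj D ⟶ (Over.pullback p).obj D')
    (hh : ∀ ⦃T : C⦄ (x y : T ⟶ pullback D.hom p), x ≫ pullback.fst _ _ = y ≫ pullback.fst _ _ →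
      x ≫ h.left ≫ pullback.fst D'.hom p = y ≫ h.left ≫ pullback.fst D'.hom p) :
    ∃ m : (Monad.comparison (Over.mapPullbackAdj p)).obj D ⟶
      (Monad.comparison (Over.mapPullbackAdj p)).obj D', m.f = h := by
  refine ⟨⟨h, Over.OverMorphism.ext ?_⟩, rfl⟩
  have key : ∀ (h' : pullback D.hom p ⟶ pullback D'.hom p)
      (r : pullback (pullback.snd D.hom p ≫ p) p ⟶ pullback D.hom p)
      (r' : pullback (pullback.snd D'.hom p ≫ p) p ⟶ pullback D'.hom p)
      (t : pullback (pullback.snd D.hom p ≫ p) p ⟶ pullback (pullback.snd D'.hom p ≫ p) p),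
      h' ≫ pullback.snd _ _ = pullback.snd _ _ →
      (∀ ⦃T : C⦄ (x y : T ⟶ pullback D.hom p), x ≫ pullback.fst _ _ = y ≫ pullback.fst _ _ →
        x ≫ h' ≫ pullback.fst D'.hom p = y ≫ h' ≫ pullback.fst D'.hom p) →
      r ≫ pullback.fst _ _ = pullback.fst _ _ ≫ pullback.fst _ _ →
      r ≫ pullback.snd _ _ = pullback.snd _ _ →
      r' ≫ pullback.fst _ _ = pullback.fst _ _ ≫ pullback.fst _ _ →
      r' ≫ pullback.snd _ _ = pullback.snd _ _ →
      t ≫ pullback.fst _ _ = pullback.fst _ _ ≫ h' →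
      t ≫ pullback.snd _ _ = pullback.snd _ _ → t ≫ r' = r ≫ h' := by
    intro h' r r' t hs hf r₁ r₂ r₁' r₂' t₁ t₂
    apply pullback.hom_ext
    · rw [Category.assoc, r₁', reassoc_of% t₁, Category.assoc]
      exact hf _ _ r₁.symm
    · rw [Category.assoc, r₂', t₂, Category.assoc, hs, r₂]
  exact key h.left _ _ _ (Over.w h) hh (pullback_counit_fst p D) (pullback_counit_snd p D)
    (pullback_counit_fst p D') (pullback_counit_snd p D') (monad_map_fst p h) (monad_map_snd p h)

/-- Conversely, algebra morphisms respect these fibres, because the structure map of a base change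
moves between any two elements of a fibre. -/
theorem comparison_hom_respects {D D' : Over B}
    (m : (Monad.comparison (Over.mapPullbackAdj p)).obj D ⟶
      (Monad.comparison (Over.mapPullbackAdj p)).obj D')
    ⦃T : C⦄ (x y : T ⟶ pullback D.hom p) (hxy : x ≫ pullback.fst _ _ = y ≫ pullback.fst _ _) :
    x ≫ Over.Hom.left m.f ≫ pullback.fst D'.hom p =
      y ≫ Over.Hom.left m.f ≫ pullback.fst D'.hom p := by
  have key : ∀ (h : pullback D.hom p ⟶ pullback D'.hom p)
      (r : pullback (pullback.snd D.hom p ≫ p) p ⟶ pullback D.hom p)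
      (r' : pullback (pullback.snd D'.hom p ≫ p) p ⟶ pullback D'.hom p)
      (t : pullback (pullback.snd D.hom p ≫ p) p ⟶ pullback (pullback.snd D'.hom p ≫ p) p),
      r ≫ pullback.fst _ _ = pullback.fst _ _ ≫ pullback.fst _ _ →
      r ≫ pullback.snd _ _ = pullback.snd _ _ →
      r' ≫ pullback.fst _ _ = pullback.fst _ _ ≫ pullback.fst _ _ →
      t ≫ pullback.fst _ _ = pullback.fst _ _ ≫ h → t ≫ r' = r ≫ h →
      x ≫ h ≫ pullback.fst D'.hom p = y ≫ h ≫ pullback.fst D'.hom p := by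
    intro h r r' t r₁ r₂ r₁' t₁ e
    let z : T ⟶ pullback (pullback.snd D.hom p ≫ p) p := pullback.lift x (y ≫ pullback.snd _ _)
      (by simp only [Category.assoc, ← pullback.condition, reassoc_of% hxy])
    have hz : z ≫ r = y := by
      apply pullback.hom_ext
      · rw [Category.assoc, r₁, pullback.lift_fst_assoc, hxy]
      · rw [Category.assoc, r₂, pullback.lift_snd]
    rw [← hz, Category.assoc, ← reassoc_of% e, r₁', reassoc_of% t₁, pullback.lift_fst_assoc]
  exact key _ _ _ _ (pullback_counit_fst p D) (pullback_counit_snd p D)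
    (pullback_counit_fst p D') (monad_map_fst p m.f) (congrArg Over.Hom.left m.h)

theorem IsEffectiveDescent.fullyFaithful {p : A ⟶ B} (hp : IsEffectiveDescent p) :
    DescentFullyFaithful p := by
  intro P D D' s q d d' g hP hg hinv
  have : (Monad.comparison (Over.mapPullbackAdj p)).IsEquivalence := hp
  let X : Over B := Over.mk d
  let Y : Over B := Over.mk d'
  let i : pullback d p ⟶ P := hP.isoPullback.inv
  have i₁ : i ≫ s = pullback.fst d p := hP.isoPullback_inv_fst
  have i₂ : i ≫ q = pullback.snd d p := hP.isoPullback_inv_snd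
  let l : pullback d p ⟶ pullback d' p := pullback.lift (i ≫ g) (pullback.snd d p)
    (by rw [Category.assoc, hg, reassoc_of% i₂])
  let h : (Over.pullback p).obj X ⟶ (Over.pullback p).obj Y :=
    Over.homMk l (pullback.lift_snd _ _ _)
  obtain ⟨m, hm⟩ := comparison_hom_exists p h (fun T x y hxy => by
    have hl : l ≫ pullback.fst d' p = i ≫ g := pullback.lift_fst _ _ _
    change x ≫ l ≫ pullback.fst d' p = y ≫ l ≫ pullback.fst d' p
    rw [hl, ← Category.assoc, ← Category.assoc]
    refine hinv _ _ ?_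
    rw [Category.assoc, Category.assoc, i₁]
    exact hxy)
  obtain ⟨k, rfl⟩ := (Monad.comparison (Over.mapPullbackAdj p)).map_surjective m
  have hk : (Over.pullback p).map k = h := hm
  have hfst : ∀ k' : X ⟶ Y, s ≫ k'.left = g ↔ (Over.pullback p).map k' = h := by
    intro k'
    have e₁ : ((Over.pullback p).map k').left ≫ pullback.fst d' p = pullback.fst d p ≫ k'.left :=
      pullback_map_fst p k'
    have e₂ : l ≫ pullback.fst d' p = i ≫ g := pullback.lift_fst _ _ _
    constructor
    · intro e
      refine Over.OverMorphism.ext (pullback.hom_ext ?_ ?_)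
      · exact e₁.trans ((by rw [← e, ← i₁, Category.assoc] :
          pullback.fst d p ≫ k'.left = i ≫ g).trans e₂.symm)
      · exact (pullback_map_snd p k').trans (pullback.lift_snd _ _ _).symm
    · intro e
      rw [e] at e₁
      have e₃ : i ≫ s ≫ k'.left = i ≫ g := by
        rw [reassoc_of% i₁, ← e₂]
        exact e₁.symm
      exact (cancel_epi i).1 e₃
  refine ⟨k.left, ⟨Over.w k, (hfst k).2 hk⟩, ?_⟩
  rintro k' ⟨hk₁, hk₂⟩
  have e := (hfst (Over.homMk k' hk₁)).1 hk₂
  have : (Over.homMk k' hk₁ : X ⟶ Y) = k :=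
    (Monad.comparison (Over.mapPullbackAdj p)).map_injective
      (Monad.Algebra.Hom.ext (e.trans hk.symm))
  exact congrArg Over.Hom.left this

theorem IsEffectiveDescent.effective {p : A ⟶ B} (hp : IsEffectiveDescent p) :
    DescentEffective p := by
  intro E q M
  have : (Monad.comparison (Over.mapPullbackAdj p)).IsEquivalence := hp
  let D := (Monad.comparison (Over.mapPullbackAdj p)).objPreimage M.toAlgebra
  let φ : (Monad.comparison (Over.mapPullbackAdj p)).obj D ≅ M.toAlgebra :=
    (Monad.comparison (Over.mapPullbackAdj p)).objObjPreimageIso M.toAlgebra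
  let j : pullback D.hom p ≅ E :=
    (Over.forget A).mapIso ((Monad.forget _).mapIso φ)
  have hjq : j.hom ≫ q = pullback.snd D.hom p := Over.w φ.hom.f
  have hjq' : j.inv ≫ pullback.snd D.hom p = q := by rw [← hjq, j.inv_hom_id_assoc]
  refine ⟨D.left, D.hom, j.inv ≫ pullback.fst D.hom p, ?_, ?_⟩
  · refine IsPullback.of_iso (IsPullback.of_hasPullback D.hom p) j (Iso.refl _) (Iso.refl _)
      (Iso.refl _) ?_ ?_ ?_ ?_
    · simp
    · simp [hjq]
    · simp
    · simp
  · intro T e a h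
    have hc : (pullback.fst (q ≫ p) p ≫ q) ≫ p = pullback.snd (q ≫ p) p ≫ p := by
      rw [Category.assoc, pullback.condition]
    have key : ∀ (r : pullback (pullback.snd D.hom p ≫ p) p ⟶ pullback D.hom p)
        (t : pullback (q ≫ p) p ⟶ pullback (pullback.snd D.hom p ≫ p) p),
        r ≫ pullback.fst _ _ = pullback.fst _ _ ≫ pullback.fst _ _ →
        t ≫ pullback.fst _ _ = pullback.fst _ _ ≫ j.inv → t ≫ r = M.act _ _ hc ≫ j.inv →
        M.act e a h ≫ j.inv ≫ pullback.fst D.hom p = e ≫ j.inv ≫ pullback.fst D.hom p := by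
      intro r t r₁ t₁ hm
      let z : T ⟶ pullback (q ≫ p) p := pullback.lift e a (by rw [← h, Category.assoc])
      have z₁ : z ≫ pullback.fst _ _ = e := pullback.lift_fst _ _ _
      have z₂ : z ≫ pullback.snd _ _ = a := pullback.lift_snd _ _ _
      have hz : z ≫ M.act _ _ hc = M.act e a h :=
        (M.comp_act z _ _ hc (by rw [z₁, z₂, h])).trans (M.act_congr _ z₁ z₂)
      rw [← hz, Category.assoc, ← reassoc_of% hm, r₁, reassoc_of% t₁, reassoc_of% z₁]
    exact key _ _ (pullback_counit_fst p D) (monad_map_fst p φ.inv.f)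
      (congrArg Over.Hom.left φ.inv.h)

theorem IsEffectiveDescent.of_fullyFaithful_of_effective {p : A ⟶ B}
    (h₁ : DescentFullyFaithful p) (h₂ : DescentEffective p) : IsEffectiveDescent p := by
  have hff : ∀ {D D' : Over B} (g : pullback D.hom p ⟶ D'.left),
      g ≫ D'.hom = pullback.snd _ _ ≫ p →
      (∀ ⦃T : C⦄ (x y : T ⟶ pullback D.hom p), x ≫ pullback.fst _ _ = y ≫ pullback.fst _ _ →
        x ≫ g = y ≫ g) →
      ∃! k : D.left ⟶ D'.left, k ≫ D'.hom = D.hom ∧ pullback.fst _ _ ≫ k = g :=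
    fun g hg hinv => h₁ _ _ _ _ g (IsPullback.of_hasPullback _ _) hg hinv
  have faithful : (Monad.comparison (Over.mapPullbackAdj p)).Faithful := by
    refine ⟨fun {D D'} k k' hk => Over.OverMorphism.ext ?_⟩
    have hk' : (Over.pullback p).map k = (Over.pullback p).map k' :=
      congrArg Monad.Algebra.Hom.f hk
    refine (hff (pullback.fst _ _ ≫ k.left) ?_ ?_).unique ⟨Over.w k, rfl⟩ ⟨Over.w k', ?_⟩
    · rw [Category.assoc, Over.w, pullback.condition]
    · intro T x y hxy
      rw [reassoc_of% hxy]
    · rw [← pullback_map_fst, ← pullback_map_fst, hk']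
  have full : (Monad.comparison (Over.mapPullbackAdj p)).Full := by
    refine ⟨fun {D D'} m => ?_⟩
    let h : (Over.pullback p).obj D ⟶ (Over.pullback p).obj D' := m.f
    let l : pullback D.hom p ⟶ pullback D'.hom p := h.left
    have hl : l ≫ pullback.snd _ _ = pullback.snd _ _ := Over.w h
    obtain ⟨k, ⟨hk₁, hk₂⟩, -⟩ := hff (l ≫ pullback.fst _ _)
      (by rw [Category.assoc, pullback.condition, reassoc_of% hl])
      (comparison_hom_respects p m)
    refine ⟨Over.homMk k hk₁,
      Monad.Algebra.Hom.ext (Over.OverMorphism.ext (pullback.hom_ext ?_ ?_))⟩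
    · exact (pullback_map_fst p _).trans hk₂
    · exact (pullback_map_snd p _).trans hl.symm
  have essSurj : (Monad.comparison (Over.mapPullbackAdj p)).EssSurj := by
    refine ⟨fun M => ?_⟩
    obtain ⟨D, d, s, hP, hs⟩ := h₂ _ (DescentAction.ofAlgebra M)
    refine ⟨Over.mk d, ⟨Iso.symm (Monad.Algebra.isoMk (Over.isoMk hP.isoPullback ?_) ?_)⟩⟩
    · exact hP.isoPullback_hom_snd
    · refine Over.OverMorphism.ext ?_
      let ξ : pullback (M.A.hom ≫ p) p ⟶ M.A.left := Over.Hom.left M.a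
      have hξ : ξ ≫ M.A.hom = pullback.snd _ _ := Over.w M.a
      have hξs : ξ ≫ s = pullback.fst _ _ ≫ s := by
        have e := hs (pullback.fst (M.A.hom ≫ p) p) (pullback.snd (M.A.hom ≫ p) p)
          (by rw [Category.assoc, pullback.condition])
        have e' : (pullback.lift (pullback.fst (M.A.hom ≫ p) p) (pullback.snd (M.A.hom ≫ p) p)
          pullback.condition ≫ ξ) ≫ s = pullback.fst _ _ ≫ s := e
        rwa [pullback.lift_fst_snd, Category.id_comp] at e'
      have key : ∀ (r : pullback (pullback.snd d p ≫ p) p ⟶ pullback d p)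
          (t : pullback (M.A.hom ≫ p) p ⟶ pullback (pullback.snd d p ≫ p) p),
          r ≫ pullback.fst _ _ = pullback.fst _ _ ≫ pullback.fst _ _ →
          r ≫ pullback.snd _ _ = pullback.snd _ _ →
          t ≫ pullback.fst _ _ = pullback.fst _ _ ≫ hP.isoPullback.hom →
          t ≫ pullback.snd _ _ = pullback.snd _ _ → t ≫ r = ξ ≫ hP.isoPullback.hom := by
        intro r t r₁ r₂ t₁ t₂
        apply pullback.hom_ext
        · rw [Category.assoc, r₁, reassoc_of% t₁, hP.isoPullback_hom_fst, Category.assoc,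
            hP.isoPullback_hom_fst, hξs]
        · rw [Category.assoc, r₂, t₂, Category.assoc, hP.isoPullback_hom_snd, hξ]
      exact key _ _ (pullback_counit_fst p (Over.mk d)) (pullback_counit_snd p (Over.mk d))
        (monad_map_fst p _) (monad_map_snd p _)
  exact { }

end GeneralizedElements

/-! ### Effective descent in the category of families -/

namespace Fam

variable {X : Type u} [CompleteLattice X] {P Q : Fam X}

theorem congr_map {f g : P ⟶ Q} (h : f = g) (i : P.index) : f.map i = g.map i := by
  rw [h]

/-- The family with a single member `t`. -/
def single (t : X) : Fam X := ⟨PUnit, fun _ => t⟩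

/-- Members of a family above `t` are the same as morphisms out of the singleton family `t`. -/
def singleHom {t : X} (i : P.index) (h : t ≤ P.val i) : single t ⟶ P := ⟨fun _ => i, fun _ => h⟩

/-- The members of `P` over `j` along `f`, with new values `z`. -/
def fibre (f : P ⟶ Q) (j : Q.index) (z : {i // f.map i = j} → X) : Fam X := ⟨{i // f.map i = j}, z⟩

/-- Faithfulness of change of base, tested on singleton families: below `Q.val j`, meets distribute
over the join of the members of `P` that lie over `j`. -/
theorem le_of_descentFullyFaithful {f : P ⟶ Q} (hf : DescentFullyFaithful f) {j : Q.index} {w u : X}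
    (hw : w ≤ Q.val j) (hu : ∀ i, f.map i = j → w ⊓ P.val i ≤ u) : w ≤ u := by
  let R : Fam X := fibre f j fun i => w ⊓ P.val i.1
  let s : R ⟶ single w := ⟨fun _ => PUnit.unit, fun _ => inf_le_left⟩
  let q : R ⟶ P := ⟨fun i => i.1, fun _ => inf_le_right⟩
  let d : single w ⟶ Q := singleHom j hw
  have hsq : s ≫ d = q ≫ f := hom_ext fun i => i.2.symm
  have hP : IsPullback s q d f := by
    refine ⟨⟨hsq⟩, ⟨PullbackCone.IsLimit.mk hsq
      (fun c => ⟨fun k => ⟨c.snd.map k, (congr_map c.condition k).symm⟩,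
        fun k => le_inf (c.fst.val_le k) (c.snd.val_le k)⟩) (fun c => rfl) (fun c => rfl) ?_⟩⟩
    intro c m _ h₂
    exact hom_ext fun k => Subtype.ext (congr_map h₂ k)
  -- the target has value `w ⊓ u`, so that it lies over `j`
  let d' : single (w ⊓ u) ⟶ Q := singleHom j (inf_le_left.trans hw)
  let g : R ⟶ single (w ⊓ u) := ⟨fun _ => PUnit.unit, fun i => le_inf inf_le_left (hu i.1 i.2)⟩
  obtain ⟨k, -, -⟩ := hf s q d d' g hP (hom_ext fun i => i.2.symm)
    fun T x y _ => hom_ext fun _ => rfl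
  exact (k.val_le PUnit.unit).trans inf_le_right

/-- Effectiveness of the action on a single fibre: a compatible family `z` on the fibre over `j`
is cut out by its join. -/
theorem inf_iSup_le_of_descentEffective {f : P ⟶ Q} (hf : DescentEffective f) {j : Q.index}
    (z : {i // f.map i = j} → X) (hz : ∀ i, z i ≤ P.val i.1)
    (hz' : ∀ i i', P.val i'.1 ⊓ z i ≤ z i') (i : {i // f.map i = j}) :
    P.val i.1 ⊓ ⨆ i', z i' ≤ z i := by
  let E : Fam X := fibre f j z
  let q : E ⟶ P := ⟨fun i => i.1, hz⟩
  have hfib : ∀ {T : Fam X} (e : T ⟶ E) (a : T ⟶ P), (e ≫ q) ≫ f = a ≫ f →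
      ∀ t, f.map (a.map t) = j := fun e a h t => (congr_map h t).symm.trans (e.map t).2
  let M : DescentAction f q :=
    { act := fun e a h => ⟨fun t => ⟨a.map t, hfib e a h t⟩, fun t =>
        (le_inf (a.val_le t) (e.val_le t)).trans (hz' (e.map t) ⟨a.map t, hfib e a h t⟩)⟩
      act_comp := fun _ _ _ => rfl
      comp_act := fun _ _ _ _ _ => rfl
      act_self := fun _ => rfl
      act_act := fun _ _ _ _ _ _ => rfl }
  obtain ⟨D, d, s, hP, hs⟩ := hf q M
  have hconst : ∀ i', s.map i' = s.map i := fun i' =>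
    congr_map (hs (singleHom (P := E) (t := ⊥) i bot_le) (singleHom i'.1 bot_le)
      (hom_ext fun _ => i.2.trans i'.2.symm)) PUnit.unit
  have hle : ⨆ i', z i' ≤ D.val (s.map i) :=
    iSup_le fun i' => (s.val_le i').trans_eq (congrArg D.val (hconst i'))
  let x : single (P.val i.1 ⊓ ⨆ i', z i') ⟶ D := singleHom (s.map i) (inf_le_right.trans hle)
  let a : single (P.val i.1 ⊓ ⨆ i', z i') ⟶ P := singleHom i.1 inf_le_left
  have hxa : x ≫ d = a ≫ f := hom_ext fun _ => congr_map hP.w i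
  have hi : (hP.lift x a hxa).map PUnit.unit = i :=
    Subtype.ext (congr_map (hP.lift_snd x a hxa) PUnit.unit)
  exact ((hP.lift x a hxa).val_le PUnit.unit).trans_eq (congrArg z hi)

end Fam

/-! ### Pullbacks of spaces and ultrafilters -/

section Pullbacks

variable {P D A B : TopCat.{u}} {s : P ⟶ D} {q : P ⟶ A} {d : D ⟶ B} {p : A ⟶ B}

/-- The map from a point that picks `x`. -/
abbrev pointMap (x : P) : TopCat.of PUnit.{u + 1} ⟶ P := TopCat.ofHom (ContinuousMap.const _ x)

theorem TopCat.isPullback_ext (hP : IsPullback s q d p) {x y : P} (h₁ : s x = s y)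
    (h₂ : q x = q y) : x = y := by
  have : pointMap x = pointMap y := by
    apply hP.hom_ext
    · ext; exact h₁
    · ext; exact h₂
  exact ConcreteCategory.congr_hom this PUnit.unit

theorem TopCat.isPullback_exists (hP : IsPullback s q d p) {x : D} {a : A} (h : d x = p a) :
    ∃ y : P, s y = x ∧ q y = a := by
  have w : pointMap x ≫ d = pointMap a ≫ p := by
    ext; exact h
  exact ⟨hP.lift _ _ w PUnit.unit, ConcreteCategory.congr_hom (hP.lift_fst _ _ w) PUnit.unit,
    ConcreteCategory.congr_hom (hP.lift_snd _ _ w) PUnit.unit⟩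

theorem TopCat.isPullback_isInducing (hP : IsPullback s q d p) :
    IsInducing fun x : P => (s x, q x) := by
  have h := IsInducing.subtypeVal.comp (TopCat.homeoOfIso
    (hP.isoPullback ≪≫ TopCat.pullbackIsoProdSubtype d p)).isInducing
  convert h using 1
  funext x
  exact Prod.ext (ConcreteCategory.congr_hom hP.isoPullback_hom_fst x).symm
    (ConcreteCategory.congr_hom hP.isoPullback_hom_snd x).symm

theorem TopCat.isPullback_of_isInducing (w : s ≫ d = q ≫ p)
    (hi : IsInducing fun x : P => (s x, q x))
    (he : ∀ x a, d x = p a → ∃! y : P, s y = x ∧ q y = a) : IsPullback s q d p := by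
  refine ⟨⟨w⟩, ⟨PullbackCone.IsLimit.mk w (fun c => TopCat.ofHom
    ⟨fun t => (he (c.fst t) (c.snd t) (ConcreteCategory.congr_hom c.condition t)).choose, ?_⟩)
    (fun c => ?_) (fun c => ?_) ?_⟩⟩
  · rw [hi.continuous_iff]
    convert c.fst.hom.continuous.prodMk c.snd.hom.continuous using 2 with t
    have h := (he (c.fst t) (c.snd t) (ConcreteCategory.congr_hom c.condition t)).choose_spec.1
    exact Prod.ext h.1 h.2
  · ext t
    exact (he (c.fst t) (c.snd t) (ConcreteCategory.congr_hom c.condition t)).choose_spec.1.1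
  · ext t
    exact (he (c.fst t) (c.snd t) (ConcreteCategory.congr_hom c.condition t)).choose_spec.1.2
  · intro c m h₁ h₂
    ext t
    exact (he (c.fst t) (c.snd t) (ConcreteCategory.congr_hom c.condition t)).choose_spec.2 _
      ⟨ConcreteCategory.congr_hom h₁ t, ConcreteCategory.congr_hom h₂ t⟩

/-- Ultrafilters with the same image in the base lift to any set-theoretic pullback. -/
theorem exists_ultrafilter_map_eq {α β γ δ : Type*} {s : δ → β} {q : δ → α} {d : β → γ}
    {p : α → γ} (he : ∀ x a, d x = p a → ∃ y, s y = x ∧ q y = a) (𝔡 : Ultrafilter β)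
    (𝔞 : Ultrafilter α) (h : 𝔡.map d = 𝔞.map p) :
    ∃ 𝔢 : Ultrafilter δ, 𝔢.map s = 𝔡 ∧ 𝔢.map q = 𝔞 := by
  have hne : (comap s 𝔡 ⊓ comap q 𝔞 : Filter δ).NeBot := by
    rw [((𝔡 : Filter β).basis_sets.comap s).inf_basis_neBot_iff ((𝔞 : Filter α).basis_sets.comap q)]
    intro S hS R hR
    have h₁ : d '' S ∈ 𝔞.map p := h ▸ image_mem_map hS
    obtain ⟨a, haR, x, hxS, hxa⟩ := 𝔞.nonempty_of_mem (inter_mem hR h₁)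
    obtain ⟨y, rfl, rfl⟩ := he x a hxa
    exact ⟨y, hxS, haR⟩
  let 𝔢 := Ultrafilter.of (comap s 𝔡 ⊓ comap q 𝔞)
  have hle : (𝔢 : Filter δ) ≤ comap s 𝔡 ⊓ comap q 𝔞 := Ultrafilter.of_le _
  exact ⟨𝔢, Ultrafilter.coe_le_coe.1 (map_le_iff_le_comap.2 (hle.trans inf_le_left)),
    Ultrafilter.coe_le_coe.1 (map_le_iff_le_comap.2 (hle.trans inf_le_right))⟩

end Pullbacks

/-! ### Smallest convergence points -/

section SmallestLimits

variable {X : Type u} [TopologicalSpace X] [TopologicalInfLattice X] {σ : Ultrafilter X → X}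

theorem IsLeftAdjointOfUnit.le_iff_le_nhds (hσ : IsLeftAdjointOfUnit σ) {𝔵 : Ultrafilter X}
    {x : X} : σ 𝔵 ≤ x ↔ (𝔵 : Filter X) ≤ 𝓝 x := by
  rw [hσ.le_iff, (nhds_basis_opens x).ge_iff]
  exact ⟨fun h _ hU => h _ hU.2 hU.1, fun h U hU hx => h U ⟨hx, hU⟩⟩

theorem IsLeftAdjointOfUnit.apply_pure (hσ : IsLeftAdjointOfUnit σ) (x : X) : σ (pure x) = x :=
  le_antisymm (hσ.le_iff_le_nhds.2 (pure_le_nhds x))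
    ((TopologicalInfLattice.le_iff_pure_le_nhds _ _).2 (hσ.le_iff_le_nhds.1 le_rfl))

theorem IsLeftAdjointOfUnit.map_mono (hσ : IsLeftAdjointOfUnit σ) {α : Type*} {f g : α → X}
    (hfg : ∀ a, f a ≤ g a) (𝔞 : Ultrafilter α) : σ (𝔞.map f) ≤ σ (𝔞.map g) :=
  hσ.monotone _ _ fun _ hU h => mem_of_superset (f := (𝔞 : Filter α)) h fun a ha =>
    ((TopologicalInfLattice.le_iff_specializes _ _).1 (hfg a)).mem_open hU ha

theorem IsLeftAdjointOfUnit.continuous_iff (hσ : IsLeftAdjointOfUnit σ) {Y : Type*}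
    [TopologicalSpace Y] {f : Y → X} :
    Continuous f ↔ ∀ (𝔶 : Ultrafilter Y) (y : Y), (𝔶 : Filter Y) ≤ 𝓝 y → σ (𝔶.map f) ≤ f y := by
  rw [continuous_iff_ultrafilter, forall_comm]
  simp only [hσ.le_iff_le_nhds]
  rfl

theorem InfPreservesSmallestLimits.map_inf_map (hσ : InfPreservesSmallestLimits σ) {α : Type u}
    (f g : α → X) (𝔞 : Ultrafilter α) :
    σ (𝔞.map fun a => f a ⊓ g a) = σ (𝔞.map f) ⊓ σ (𝔞.map g) :=
  hσ.map_inf (𝔞.map fun a => (f a, g a))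

end SmallestLimits

/-! ### Pullbacks and actions in the lax comma category -/

namespace LaxTop

variable {X : Type u} [TopologicalSpace X]

theorem congr_map {P Q : LaxTop X} {f g : P ⟶ Q} (h : f = g) : f.map = g.map := by
  rw [h]

variable [TopologicalInfLattice X]

theorem val_le_val {P Q : LaxTop X} (f : P ⟶ Q) (a : P.space) : P.val a ≤ Q.val (f.map a) :=
  (TopologicalInfLattice.le_iff_specializes _ _).2 (f.val_le a)

/-- A morphism given by its underlying continuous map. -/
def ofLE {P Q : LaxTop X} (g : P.space ⟶ Q.space) (h : ∀ a, P.val a ≤ Q.val (g a)) : P ⟶ Q :=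
  ⟨g, fun a => (TopologicalInfLattice.le_iff_specializes _ _).1 (h a)⟩

/-- The space `T` with constant value `t`. -/
def const (T : TopCat.{u}) (t : X) : LaxTop X := ⟨T, ContinuousMap.const _ t⟩

/-- A space with constant value `⊥` is free on the space. -/
def ofBot {T : TopCat.{u}} {Q : LaxTop X} (g : T ⟶ Q.space) : const (X := X) T ⊥ ⟶ Q :=
  ofLE g fun _ => bot_le

/-- The point of `P` given by `e`, with any smaller value. -/
def pointHom {P : LaxTop X} {t : X} (e : P.space) (h : t ≤ P.val e) :
    const (TopCat.of PUnit) t ⟶ P :=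
  ofLE (pointMap e) fun _ => h

theorem pointHom_comp_eq {P Q R : LaxTop X} {t : X} {e : P.space} {a : Q.space}
    {he : t ≤ P.val e} {ha : t ≤ Q.val a} {g : P ⟶ R} {h : Q ⟶ R} (hga : g.map e = h.map a) :
    pointHom e he ≫ g = pointHom a ha ≫ h :=
  hom_ext (by ext; exact hga)

variable {E D A B : LaxTop X} {s : E ⟶ D} {q : E ⟶ A} {d : D ⟶ B} {f : A ⟶ B}

/-- Pullbacks are computed in spaces, with the pointwise meet of the values. -/
theorem isPullback_iff : IsPullback s q d f ↔ IsPullback s.map q.map d.map f.map ∧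
    ∀ e, D.val (s.map e) ⊓ A.val (q.map e) ≤ E.val e := by
  constructor
  · intro h
    have hTop : IsPullback s.map q.map d.map f.map := by
      have hw : ∀ c : PullbackCone d.map f.map, ofBot c.fst ≫ d = ofBot c.snd ≫ f :=
        fun c => hom_ext c.condition
      refine ⟨⟨congr_map h.w⟩, ⟨PullbackCone.IsLimit.mk _
        (fun c => (h.lift (ofBot c.fst) (ofBot c.snd) (hw c)).map)
        (fun c => congr_map (h.lift_fst _ _ (hw c)))
        (fun c => congr_map (h.lift_snd _ _ (hw c))) ?_⟩⟩
      intro c m h₁ h₂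
      have : ofBot m = h.lift (ofBot c.fst) (ofBot c.snd) (hw c) := by
        apply h.hom_ext
        · rw [h.lift_fst]
          exact hom_ext h₁
        · rw [h.lift_snd]
          exact hom_ext h₂
      exact congr_map this
    refine ⟨hTop, fun e => ?_⟩
    have hw : pointHom (t := D.val (s.map e) ⊓ A.val (q.map e)) (s.map e) inf_le_left ≫ d =
        pointHom (q.map e) inf_le_right ≫ f :=
      pointHom_comp_eq (ConcreteCategory.congr_hom (congr_map h.w) e)
    have he : (h.lift _ _ hw).map PUnit.unit = e := TopCat.isPullback_ext hTop
      (ConcreteCategory.congr_hom (congr_map (h.lift_fst _ _ hw)) PUnit.unit)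
      (ConcreteCategory.congr_hom (congr_map (h.lift_snd _ _ hw)) PUnit.unit)
    exact (val_le_val (h.lift _ _ hw) PUnit.unit).trans_eq (congrArg E.val he)
  · rintro ⟨h, hval⟩
    have hw : ∀ c : PullbackCone d f, c.fst.map ≫ d.map = c.snd.map ≫ f.map :=
      fun c => congr_map c.condition
    refine ⟨⟨hom_ext h.w⟩, ⟨PullbackCone.IsLimit.mk _
      (fun c => ofLE (h.lift c.fst.map c.snd.map (hw c)) fun t => ?_)
      (fun c => hom_ext (h.lift_fst _ _ _)) (fun c => hom_ext (h.lift_snd _ _ _)) ?_⟩⟩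
    · refine le_trans (le_inf ?_ ?_) (hval _)
      · exact (val_le_val c.fst t).trans_eq
          (congrArg D.val (ConcreteCategory.congr_hom (h.lift_fst _ _ (hw c)) t).symm)
      · exact (val_le_val c.snd t).trans_eq
          (congrArg A.val (ConcreteCategory.congr_hom (h.lift_snd _ _ (hw c)) t).symm)
    · intro c m h₁ h₂
      refine hom_ext (h.hom_ext ?_ ?_)
      · exact (congr_map h₁).trans (h.lift_fst _ _ (hw c)).symm
      · exact (congr_map h₂).trans (h.lift_snd _ _ (hw c)).symm

/-- The action of spaces underlying an action in the lax comma category, evaluated on free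
objects. -/
def topAction (M : DescentAction f q) : DescentAction f.map q.map where
  act e a h := (M.act (ofBot e) (ofBot a) (hom_ext h)).map
  act_comp e a h := congr_map (M.act_comp _ _ _)
  comp_act {S T} t e a h h' := by
    let t' : const (X := X) S ⊥ ⟶ const T ⊥ := ofLE t fun _ => le_rfl
    exact congr_map (M.comp_act t' (ofBot e) (ofBot a) (hom_ext h) (hom_ext h'))
  act_self e := congr_map (M.act_self (ofBot e))
  act_act e a a' h h' h'' := congr_map
    (M.act_act (ofBot e) (ofBot a) (ofBot a') (hom_ext h) (hom_ext h') (hom_ext h''))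

theorem topAction_act_map (M : DescentAction f q) {T : LaxTop X} (e : T ⟶ E) (a : T ⟶ A)
    (h : (e ≫ q) ≫ f = a ≫ f) :
    (topAction M).act e.map a.map (congr_map h) = (M.act e a h).map := by
  let t : const T.space ⊥ ⟶ T := ofBot (𝟙 _)
  have h' : ((t ≫ e) ≫ q) ≫ f = (t ≫ a) ≫ f := by simp only [Category.assoc] at h ⊢; rw [h]
  exact (congr_map (M.comp_act t e a h h')).symm

/-- An action of spaces that satisfies the inequality for values is an action in the lax comma
category. -/
def liftAction (M : DescentAction f.map q.map)
    (hM : ∀ {T : TopCat.{u}} (e : T ⟶ E.space) (a : T ⟶ A.space)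
      (h : (e ≫ q.map) ≫ f.map = a ≫ f.map) (t : T),
      E.val (e t) ⊓ A.val (a t) ≤ E.val (M.act e a h t)) : DescentAction f q where
  act e a h := ofLE (M.act e.map a.map (congr_map h)) fun t =>
    (le_inf (val_le_val e t) (val_le_val a t)).trans (hM _ _ _ t)
  act_comp _ _ _ := hom_ext (M.act_comp _ _ _)
  comp_act _ _ _ _ _ := hom_ext (M.comp_act _ _ _ _ _)
  act_self _ := hom_ext (M.act_self _)
  act_act _ _ _ _ _ _ := hom_ext (M.act_act _ _ _ _ _ _)

/-- The inequality that an action in the lax comma category adds to the action of spaces. -/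
theorem val_inf_val_le (M : DescentAction f q) {D' : TopCat.{u}} {s' : E.space ⟶ D'}
    {d' : D' ⟶ B.space} (hP : IsPullback s' q.map d' f.map)
    (hs : ∀ ⦃T : TopCat.{u}⦄ (e : T ⟶ E.space) (a : T ⟶ A.space)
      (h : (e ≫ q.map) ≫ f.map = a ≫ f.map), (topAction M).act e a h ≫ s' = e ≫ s')
    {e e' : E.space} (h : s' e = s' e') : A.val (q.map e') ⊓ E.val e ≤ E.val e' := by
  have hw : ∀ x, d' (s' x) = f.map (q.map x) := ConcreteCategory.congr_hom hP.w
  let e₁ : const (TopCat.of PUnit) (A.val (q.map e') ⊓ E.val e) ⟶ E := pointHom e inf_le_right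
  let a₁ : const (TopCat.of PUnit) (A.val (q.map e') ⊓ E.val e) ⟶ A :=
    pointHom (q.map e') inf_le_left
  have h₁ : (e₁ ≫ q) ≫ f = a₁ ≫ f := by
    rw [Category.assoc]
    exact pointHom_comp_eq ((hw e).symm.trans ((congrArg d' h).trans (hw e')))
  have he : (M.act e₁ a₁ h₁).map PUnit.unit = e' := by
    apply TopCat.isPullback_ext hP
    · refine Eq.trans ?_ h
      rw [← topAction_act_map]
      exact ConcreteCategory.congr_hom (hs e₁.map a₁.map (congr_map h₁)) PUnit.unit
    · exact ConcreteCategory.congr_hom (congr_map (M.act_comp e₁ a₁ h₁)) PUnit.unit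
  exact (val_le_val (M.act e₁ a₁ h₁) PUnit.unit).trans_eq (congrArg E.val he)

/-! ### Descending from spaces to the lax comma category -/

/-- The map that descends in spaces satisfies the inequality for values, since values over `b` are
detected on the fibre over `b`. -/
theorem descentFullyFaithful_of_top (hTop : DescentFullyFaithful f.map)
    (hle : ∀ (b : B.space) (w u : X), w ≤ B.val b →
      (∀ a, f.map a = b → w ⊓ A.val a ≤ u) → w ≤ u) : DescentFullyFaithful f := by
  intro P D D' s q d d' g hP hg hinv
  obtain ⟨hP', hval⟩ := isPullback_iff.1 hP
  obtain ⟨k, ⟨hk₁, hk₂⟩, hk⟩ := hTop s.map q.map d.map d'.map g.map hP' (congr_map hg)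
    fun T x y hxy => congr_map (hinv (ofBot x) (ofBot y) (hom_ext hxy))
  have hkle : ∀ x, D.val x ≤ D'.val (k x) := by
    intro x
    refine hle (d.map x) _ _ (val_le_val d x) fun a ha => ?_
    obtain ⟨e, rfl, rfl⟩ := TopCat.isPullback_exists hP' ha.symm
    exact (hval e).trans ((val_le_val g e).trans_eq
      (congrArg D'.val (ConcreteCategory.congr_hom hk₂ e).symm))
  exact ⟨ofLE k hkle, ⟨hom_ext hk₁, hom_ext hk₂⟩,
    fun k' hk' => hom_ext (hk _ ⟨congr_map hk'.1, congr_map hk'.2⟩)⟩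

/-- The values of the descended object are the joins `δ` over the fibres; the ultrafilter condition
makes `δ` continuous. -/
theorem descentEffective_of_top {σ : Ultrafilter X → X} (hσ : InfPreservesSmallestLimits σ)
    (hTop : DescentEffective f.map)
    (hsup : ∀ (b : B.space) (z : {a // f.map a = b} → X), (∀ a, z a ≤ A.val a.1) →
      (∀ a a', A.val a'.1 ⊓ z a ≤ z a') → ∀ a, A.val a.1 ⊓ ⨆ a', z a' ≤ z a)
    (hlub : ∀ (𝔟 : Ultrafilter B.space) (b : B.space), (𝔟 : Filter B.space) ≤ 𝓝 b →
      ∀ w : X, w ≤ σ (𝔟.map B.val) →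
        IsLUB {x : X | ∃ (𝔞 : Ultrafilter A.space) (a : A.space),
          (𝔞 : Filter A.space) ≤ 𝓝 a ∧ 𝔞.map f.map = 𝔟 ∧ f.map a = b ∧
            x = w ⊓ σ (𝔞.map A.val)} w) : DescentEffective f := by
  intro E q M
  obtain ⟨D, d, s, hP, hs⟩ := hTop q.map (topAction M)
  have hw : ∀ x, d (s x) = f.map (q.map x) := ConcreteCategory.congr_hom hP.w
  let δ : D → X := fun x => ⨆ e : {e // s e = x}, E.val e.1
  have hεδ : ∀ e, E.val e ≤ δ (s e) := fun e =>
    le_iSup (fun e' : {e' // s e' = s e} => E.val e'.1) ⟨e, rfl⟩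
  have hδβ : ∀ x, δ x ≤ B.val (d x) := by
    refine fun x => iSup_le ?_
    rintro ⟨e, rfl⟩
    exact ((val_le_val q e).trans (val_le_val f _)).trans_eq (congrArg B.val (hw e).symm)
  have hδε : ∀ e, δ (s e) ⊓ A.val (q.map e) ≤ E.val e := by
    intro e
    -- the fibre of `s` over `s e` is identified with the fibre of `f` over `d (s e)`
    have hl : ∀ a : {a // f.map a = d (s e)}, ∃ e', s e' = s e ∧ q.map e' = a.1 :=
      fun a => TopCat.isPullback_exists hP a.2.symm
    choose l hl₁ hl₂ using hl
    have hle : l ⟨q.map e, (hw e).symm⟩ = e := TopCat.isPullback_ext hP (hl₁ _) (hl₂ _)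
    have h := hsup (d (s e)) (fun a => E.val (l a))
      (fun a => (val_le_val q _).trans_eq (congrArg A.val (hl₂ a)))
      (fun a a' => by
        have h := val_inf_val_le M hP hs ((hl₁ a).trans (hl₁ a').symm)
        rwa [hl₂ a'] at h) ⟨q.map e, (hw e).symm⟩
    rw [hle] at h
    refine le_trans (le_inf inf_le_right (inf_le_left.trans (iSup_le ?_))) h
    rintro ⟨e', he'⟩
    have ha' : f.map (q.map e') = d (s e) := by rw [← hw, he']
    have : e' = l ⟨q.map e', ha'⟩ :=
      TopCat.isPullback_ext hP (he'.trans (hl₁ _).symm) (hl₂ ⟨q.map e', ha'⟩).symm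
    refine le_iSup_of_le ⟨q.map e', ha'⟩ ?_
    exact (congrArg E.val this).le
  have hδ : Continuous δ := by
    rw [hσ.isLeftAdjoint.continuous_iff]
    intro 𝔡 x h𝔡
    have hb : ((𝔡.map d : Ultrafilter B.space) : Filter B.space) ≤ 𝓝 (d x) :=
      (map_mono h𝔡).trans d.hom.continuous.continuousAt
    refine (hlub (𝔡.map d) (d x) hb (σ (𝔡.map δ)) (hσ.isLeftAdjoint.map_mono hδβ 𝔡)).2 ?_
    rintro _ ⟨𝔞, a, ha, ha𝔟, hab, rfl⟩
    obtain ⟨𝔢, rfl, rfl⟩ := exists_ultrafilter_map_eq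
      (fun x a h => TopCat.isPullback_exists hP h) 𝔡 𝔞 ha𝔟.symm
    obtain ⟨e, rfl, rfl⟩ := TopCat.isPullback_exists hP hab.symm
    have he : (𝔢 : Filter E.space) ≤ 𝓝 e := by
      rw [(TopCat.isPullback_isInducing hP).nhds_eq_comap, ← map_le_iff_le_comap, nhds_prod_eq]
      exact Tendsto.prodMk h𝔡 ha
    calc σ ((𝔢.map s).map δ) ⊓ σ ((𝔢.map q.map).map A.val)
        = σ (𝔢.map fun y => δ (s y) ⊓ A.val (q.map y)) := (hσ.map_inf_map _ _ 𝔢).symm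
      _ ≤ σ (𝔢.map E.val) := hσ.isLeftAdjoint.map_mono hδε 𝔢
      _ ≤ E.val e := hσ.isLeftAdjoint.continuous_iff.1 E.val.continuous 𝔢 e he
      _ ≤ δ (s e) := hεδ e
  let D' : LaxTop X := ⟨D, ⟨δ, hδ⟩⟩
  let s' : E ⟶ D' := ofLE s hεδ
  refine ⟨D', ofLE d hδβ, s', isPullback_iff.2 ⟨hP, hδε⟩, fun T e a h => hom_ext ?_⟩
  have := hs e.map a.map (congr_map h)
  rwa [topAction_act_map] at this

/-! ### Lifting from spaces to the lax comma category -/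

/-- Spaces over `A` and `B` are given the values pulled back from `A` and `B`. -/
theorem descentFullyFaithful_top (h : DescentFullyFaithful f) : DescentFullyFaithful f.map := by
  intro P D D' s q d d' g hP hg hinv
  have hw : ∀ x, d (s x) = f.map (q x) := ConcreteCategory.congr_hom hP.w
  let D₁ : LaxTop X := ⟨D, B.val.comp d.hom⟩
  let D₁' : LaxTop X := ⟨D', B.val.comp d'.hom⟩
  let P₁ : LaxTop X := ⟨P, A.val.comp q.hom⟩
  let s₁ : P₁ ⟶ D₁ := ofLE s fun x =>
    (val_le_val f (q x)).trans_eq (congrArg B.val (hw x).symm)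
  let q₁ : P₁ ⟶ A := ofLE q fun x => le_rfl
  let d₁ : D₁ ⟶ B := ofLE d fun x => le_rfl
  let d₁' : D₁' ⟶ B := ofLE d' fun x => le_rfl
  let g₁ : P₁ ⟶ D₁' := ofLE g fun x =>
    (val_le_val f (q x)).trans_eq (congrArg B.val (ConcreteCategory.congr_hom hg x).symm)
  obtain ⟨k, ⟨hk₁, hk₂⟩, hk⟩ := h s₁ q₁ d₁ d₁' g₁
    (isPullback_iff.2 ⟨hP, fun e => inf_le_right⟩) (hom_ext hg)
    fun T x y hxy => hom_ext (hinv x.map y.map (congr_map hxy))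
  refine ⟨k.map, ⟨congr_map hk₁, congr_map hk₂⟩, fun k' hk' => ?_⟩
  let k₁ : D₁ ⟶ D₁' := ofLE k' fun x =>
    (congrArg B.val (ConcreteCategory.congr_hom hk'.1 x).symm).le
  exact congr_map (hk k₁ ⟨hom_ext hk'.1, hom_ext hk'.2⟩)

/-- With the values pulled back from `A`, every action of spaces satisfies the inequality for
values, because it moves elements of `E` to a prescribed point of `A`. -/
theorem descentEffective_top (h : DescentEffective f) : DescentEffective f.map := by
  intro E q M
  let E₁ : LaxTop X := ⟨E, A.val.comp q.hom⟩
  let q₁ : E₁ ⟶ A := ofLE q fun x => le_rfl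
  obtain ⟨D, d, s, hP, hs⟩ := h q₁ (liftAction M fun e a h t => inf_le_right.trans_eq
    (congrArg A.val (ConcreteCategory.congr_hom (M.act_comp e a h) t).symm))
  exact ⟨D.space, d.map, s.map, (isPullback_iff.1 hP).1,
    fun T e a h => congr_map (hs (ofBot e) (ofBot a) (hom_ext h))⟩

end LaxTop

/-! ### Testing on a single convergence relation -/

/-- The set `β` with an additional limit point for the ultrafilter `𝔟`. -/
def WithLimit {β : Type u} (_ : Ultrafilter β) : Type u := Option β

namespace WithLimit

variable {β : Type u} {𝔟 : Ultrafilter β}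

/-- The inclusion of `β`. -/
def incl : β → WithLimit 𝔟 := some

/-- The additional point. -/
def limit : WithLimit 𝔟 := none

/-- The extension of a function on `β` by a value at the limit point. -/
def elim {γ : Type*} (g : β → γ) (c : γ) (x : WithLimit 𝔟) : γ := Option.elim (α := β) x c g

/-- The points of `β` are isolated, and the neighbourhoods of the limit point are the sets that
contain it and whose trace on `β` belongs to `𝔟`. -/
instance : TopologicalSpace (WithLimit 𝔟) := nhdsAdjoint limit (Filter.map incl 𝔟)

theorem le_nhds_iff {𝔡 : Ultrafilter (WithLimit 𝔟)} {x : WithLimit 𝔟} :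
    (𝔡 : Filter (WithLimit 𝔟)) ≤ 𝓝 x ↔ 𝔡 = pure x ∨ x = limit ∧ 𝔡 = 𝔟.map incl := by
  by_cases hx : x = limit
  · subst hx
    have : 𝓝 (limit : WithLimit 𝔟) = pure limit ⊔ Filter.map incl 𝔟 :=
      nhds_nhdsAdjoint_same _ _
    rw [this, Ultrafilter.le_sup_iff, ← Ultrafilter.coe_pure, ← Ultrafilter.coe_map,
      Ultrafilter.coe_le_coe, Ultrafilter.coe_le_coe]
    simp
  · have : 𝓝 x = pure x := nhds_nhdsAdjoint_of_ne _ hx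
    rw [this, ← Ultrafilter.coe_pure, Ultrafilter.coe_le_coe]
    simp [hx]

theorem continuous_elim [TopologicalSpace β] {b : β} (h : (𝔟 : Filter β) ≤ 𝓝 b) :
    Continuous (elim id b : WithLimit 𝔟 → β) := by
  rw [continuous_iff_ultrafilter]
  intro x 𝔡 h𝔡
  rcases le_nhds_iff.1 h𝔡 with rfl | ⟨rfl, rfl⟩
  · exact tendsto_pure_nhds _ _
  · exact h

end WithLimit

namespace LaxTop

variable {X : Type u} [TopologicalSpace X] [TopologicalInfLattice X] {A B : LaxTop X} {f : A ⟶ B}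

/-- The base change of the test space `WithLimit 𝔟` along `f` carries the action with values
`α ⊓ (w ⊓ β)` over the isolated points and `α ⊓ (w ⊓ u)` over the limit point. If that action is
effective, then these values are cut out by a continuous function, whose value at the limit is at
least the smallest convergence point `w` along `𝔟`. -/
theorem le_of_descentEffective {σ : Ultrafilter X → X} (hσ : InfPreservesSmallestLimits σ)
    (hTop : DescentFullyFaithful f.map) (hf : DescentEffective f)
    (hle : ∀ (b : B.space) (w u : X), w ≤ B.val b →
      (∀ a, f.map a = b → w ⊓ A.val a ≤ u) → w ≤ u)
    {𝔟 : Ultrafilter B.space} {b : B.space} (h𝔟 : (𝔟 : Filter B.space) ≤ 𝓝 b) {w u : X}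
    (hw : w ≤ σ (𝔟.map B.val))
    (hu : ∀ (𝔞 : Ultrafilter A.space) (a : A.space), (𝔞 : Filter A.space) ≤ 𝓝 a →
      𝔞.map f.map = 𝔟 → f.map a = b → w ⊓ σ (𝔞.map A.val) ≤ u) : w ≤ u := by
  let D : TopCat.{u} := TopCat.of (WithLimit 𝔟)
  let d : D ⟶ B.space := TopCat.ofHom ⟨_, WithLimit.continuous_elim h𝔟⟩
  let δ : D → X := WithLimit.elim (𝔟 := 𝔟) (fun b' => w ⊓ B.val b') (w ⊓ u)
  have hδβ : ∀ x, δ x ≤ B.val (d x) := by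
    rintro (_ | b')
    · exact inf_le_left.trans (hw.trans
        (hσ.isLeftAdjoint.continuous_iff.1 B.val.continuous 𝔟 b h𝔟))
    · exact inf_le_right
  have hδ𝔟 : σ ((𝔟.map (WithLimit.incl : B.space → WithLimit 𝔟)).map δ) = w := by
    have h₁ := hσ.map_inf_map (fun _ => w) B.val 𝔟
    have h₂ : 𝔟.map (fun _ => w) = pure w := by
      refine Ultrafilter.coe_injective ?_
      rw [Ultrafilter.coe_map, Filter.map_const, Ultrafilter.coe_pure]
    rw [h₂, hσ.isLeftAdjoint.apply_pure, inf_eq_left.2 hw] at h₁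
    exact h₁
  let E : TopCat.{u} := TopCat.of {p : A.space × D // f.map p.1 = d p.2}
  let q : E ⟶ A.space := TopCat.ofHom ⟨fun p => p.1.1, continuous_fst.comp continuous_subtype_val⟩
  let s : E ⟶ D := TopCat.ofHom ⟨fun p => p.1.2, continuous_snd.comp continuous_subtype_val⟩
  have hP : IsPullback s q d f.map := by
    refine TopCat.isPullback_of_isInducing (by ext p; exact p.2.symm) ?_ ?_
    · exact (Homeomorph.prodComm A.space D).isInducing.comp IsInducing.subtypeVal
    · intro x a hxa
      exact ⟨⟨(a, x), hxa.symm⟩, ⟨rfl, rfl⟩,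
        fun p hp => Subtype.ext (Prod.ext hp.2 hp.1)⟩
  have hε : Continuous fun p : E => A.val (q p) ⊓ δ (s p) := by
    rw [hσ.isLeftAdjoint.continuous_iff]
    intro 𝔢 p h𝔢
    have hq : ((𝔢.map q : Ultrafilter A.space) : Filter A.space) ≤ 𝓝 (q p) :=
      (map_mono h𝔢).trans q.hom.continuous.continuousAt
    have hs : ((𝔢.map s : Ultrafilter D) : Filter D) ≤ 𝓝 (s p) :=
      (map_mono h𝔢).trans s.hom.continuous.continuousAt
    have hqs : (𝔢.map q).map f.map = (𝔢.map s).map d :=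
      congrArg (fun g : E → B.space => 𝔢.map g) (funext fun p => p.2)
    have hα := hσ.isLeftAdjoint.continuous_iff.1 A.val.continuous _ _ hq
    refine (hσ.map_inf_map (fun p => A.val (q p)) (fun p => δ (s p)) 𝔢).trans_le ?_
    change σ ((𝔢.map q).map A.val) ⊓ σ ((𝔢.map s).map δ) ≤ _
    refine le_inf (inf_le_left.trans hα) ?_
    rcases WithLimit.le_nhds_iff.1 hs with h | ⟨h₁, h₂⟩
    · refine inf_le_right.trans ?_
      rw [h, Ultrafilter.map_pure, hσ.isLeftAdjoint.apply_pure]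
    · have hb : f.map (q p) = b := p.2.trans (congrArg d h₁)
      rw [h₂] at hqs ⊢
      rw [hδ𝔟, h₁, inf_comm]
      exact le_inf inf_le_left (hu _ _ hq
        (hqs.trans ((Ultrafilter.map_map _ _ _).trans 𝔟.map_id)) hb)
  let E₁ : LaxTop X := ⟨E, ⟨_, hε⟩⟩
  let q₁ : E₁ ⟶ A := ofLE q fun p => inf_le_left
  let M₀ : DescentAction f.map q := .ofIsPullback hP
  have hM₀ : ∀ {T : TopCat.{u}} (e : T ⟶ E) (a : T ⟶ A.space) (h : (e ≫ q) ≫ f.map = a ≫ f.map),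
      M₀.act e a h ≫ s = e ≫ s := DescentAction.ofIsPullback_act_comp hP
  let M : DescentAction f q₁ := liftAction M₀ fun e a h t => by
    have h₁ : s (M₀.act e a h t) = s (e t) := ConcreteCategory.congr_hom (hM₀ e a h) t
    have h₂ : q (M₀.act e a h t) = a t := ConcreteCategory.congr_hom (M₀.act_comp e a h) t
    change (_ ⊓ δ (s (e t))) ⊓ _ ≤ A.val (q (M₀.act e a h t)) ⊓ δ (s (M₀.act e a h t))
    rw [h₁, h₂]
    exact le_inf inf_le_right (inf_le_left.trans inf_le_right)
  obtain ⟨D', d', s', hP', hs'⟩ := hf q₁ M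
  obtain ⟨hPt, hval⟩ := isPullback_iff.1 hP'
  have hinv : ∀ ⦃T : TopCat.{u}⦄ (x y : T ⟶ E), x ≫ s = y ≫ s → x ≫ s'.map = y ≫ s'.map := by
    intro T x y hxy
    have hx : (x ≫ q) ≫ f.map = (y ≫ q) ≫ f.map := by
      rw [Category.assoc, Category.assoc, ← hP.w, reassoc_of% hxy]
    have hact : M₀.act x (y ≫ q) hx = y :=
      hP.hom_ext ((hM₀ _ _ _).trans hxy) (M₀.act_comp _ _ _)
    have h : M₀.act x (y ≫ q) hx ≫ s'.map = x ≫ s'.map :=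
      congr_map (hs' (ofBot x) (ofBot (y ≫ q)) (hom_ext hx))
    rw [← h, hact]
  -- the test space maps to the base of the effective action, with which it shares its base change
  obtain ⟨k, ⟨hk₁, hk₂⟩, -⟩ := hTop s q d d'.map s'.map hP hPt.w hinv
  have hkd : ∀ x, d'.map (k x) = d x := ConcreteCategory.congr_hom hk₁
  have hks : ∀ p, k (s p) = s'.map p := ConcreteCategory.congr_hom hk₂
  -- the continuous function on the test space obtained from effectiveness agrees with `δ`
  have hδ₁ : ∀ x, D'.val (k x) ≤ δ x := by
    intro x
    refine hle (d x) _ _ ((val_le_val d' _).trans_eq (congrArg B.val (hkd x))) fun a ha => ?_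
    have h := hval ⟨(a, x), ha⟩
    rw [← hks] at h
    exact h.trans inf_le_right
  have hδ₂ : ∀ x, δ x ≤ D'.val (k x) := by
    intro x
    refine hle (d x) _ _ (hδβ x) fun a ha => ?_
    have h := val_le_val s' ⟨(a, x), ha⟩
    rw [← hks] at h
    exact (le_of_eq (inf_comm _ _)).trans h
  have hδ : Continuous δ := by
    have : δ = fun x => D'.val (k x) := funext fun x => le_antisymm (hδ₂ x) (hδ₁ x)
    rw [this]
    exact D'.val.continuous.comp k.hom.continuous
  have h := hσ.isLeftAdjoint.continuous_iff.1 hδ (𝔟.map (WithLimit.incl : B.space → WithLimit 𝔟))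
    WithLimit.limit (WithLimit.le_nhds_iff.2 (Or.inr ⟨rfl, rfl⟩))
  rw [hδ𝔟] at h
  exact h.trans inf_le_right

end LaxTop

/-! ### The characterization -/

theorem theoremd {X : Type u} [TopologicalSpace X] [TopologicalInfLattice X]
    (σ : Ultrafilter X → X) (hσ : InfPreservesSmallestLimits σ)
    {A B : LaxTop X} (f : A ⟶ B) (hf : IsEffectiveDescent ((LaxTop.toFam X).map f)) :
    IsEffectiveDescent f ↔
      IsEffectiveDescent ((LaxTop.toTop X).map f) ∧
      ∀ (𝔟 : Ultrafilter B.space) (b : B.space), (𝔟 : Filter B.space) ≤ 𝓝 b →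
        ∀ w : X, w ≤ σ (𝔟.map B.val) →
          IsLUB {x : X | ∃ (𝔞 : Ultrafilter A.space) (a : A.space),
            (𝔞 : Filter A.space) ≤ 𝓝 a ∧ 𝔞.map f.map = 𝔟 ∧ f.map a = b ∧
              x = w ⊓ σ (𝔞.map A.val)} w := by
  have hle : ∀ (b : B.space) (w u : X), w ≤ B.val b →
      (∀ a, f.map a = b → w ⊓ A.val a ≤ u) → w ≤ u :=
    fun b w u => Fam.le_of_descentFullyFaithful hf.fullyFaithful (j := b)
  have hsup : ∀ (b : B.space) (z : {a // f.map a = b} → X), (∀ a, z a ≤ A.val a.1) →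
      (∀ a a', A.val a'.1 ⊓ z a ≤ z a') → ∀ a, A.val a.1 ⊓ ⨆ a', z a' ≤ z a :=
    fun b => Fam.inf_iSup_le_of_descentEffective hf.effective (j := b)
  constructor
  · intro h
    have hTop := LaxTop.descentFullyFaithful_top h.fullyFaithful
    refine ⟨.of_fullyFaithful_of_effective hTop (LaxTop.descentEffective_top h.effective), ?_⟩
    intro 𝔟 b h𝔟 w hw
    constructor
    · rintro _ ⟨𝔞, a, -, -, -, rfl⟩
      exact inf_le_left
    · intro u hu
      exact LaxTop.le_of_descentEffective hσ hTop h.effective hle h𝔟 hw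
        fun 𝔞 a ha h₁ h₂ => hu ⟨𝔞, a, ha, h₁, h₂, rfl⟩
  · rintro ⟨hTop, hlub⟩
    exact .of_fullyFaithful_of_effective
      (LaxTop.descentFullyFaithful_of_top hTop.fullyFaithful hle)
      (LaxTop.descentEffective_of_top hσ hTop.effective hsup hlub)
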